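/- Let $n,r\in\mathbb{Z}$ satisfy $n>1$ and $\gcd(n,r)=1$, and let $p\in\mathbb{C}[x]$ be a polynomial with $x\nmid p$. Suppose that $g,h\in\mathbb{C}(x)$ are rational functions with $g\circ h=x^r p(x)^n$. Then there exist a rational function $\mu\in\mathbb{C}(x)$ of degree one (with inverse $\mu^{-1}$ under composition), integers $i,j\in\mathbb{Z}$, and polynomials $G,H\in\mathbb{C}[x]$ such that $$g\circ\mu=x^i\,G(x)^n\qquad\text{and}\qquad \mu^{-1}\circ h=x^j\,H(x)^n.$$ Here the degree of a nonzero rational function $a/b$ in lowest terms is $\max(\deg a,\deg b)$. -/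

import Mathlib

/-- The composition `g ∘ h` of two complex rational functions, i.e. `g(h(x))`: substitute `h` for the
variable in the reduced numerator and denominator of `g` and divide. The quotient is meaningful unless
`h` is a constant equal to a pole of `g`; in that excluded case the value is the constant `0`. -/
noncomputable def ratComp (g h : RatFunc ℂ) : RatFunc ℂ :=
  RatFunc.eval RatFunc.C h g

/-- The degree of a rational function `a / b` in lowest terms: `max (deg a) (deg b)`. -/
noncomputable def ratDegree (f : RatFunc ℂ) : ℕ :=
  max f.num.natDegree f.denom.natDegree

/-- `ν` is the inverse of `μ` under composition. -/
def IsCompInverse (μ ν : RatFunc ℂ) : Prop :=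
  ratComp μ ν = RatFunc.X ∧ ratComp ν μ = RatFunc.X

open Polynomial

/-! ### Orders at finite points and the degree as order at infinity. -/

namespace RatFunc

/-! The shape `x^i G^n` is a condition on orders alone: at every nonzero finite point the order is a
nonnegative multiple of `n` (`exists_eq_zpow_mul_pow`). The function `f = g ∘ h` satisfies it, and
its order at `0` and its degree are both prime to `n`. The order of `f` at `P` is the order of `g`
at `h(P)` times the multiplicity with which `h` takes that value, so the task is to find one value
`Q` such that `h - Q` satisfies the condition and `g` satisfies it at every finite point other than
`Q`; then `μ` is `x + Q`.

Replacing `x` by `1/x` gives `f` a pole at `∞`, and a Möbius change between `g` and `h` gives `h`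
one. Then `h` has no pole at a nonzero finite point, since `f` has none there. So `h = a / x^k`.

If `k = 0`, take `Q = h(0)`: the order of `f` at `0` is prime to `n`, hence so is the order of `g`
at `Q`, which forces `n` into the multiplicities of `h - Q` elsewhere. Over any other value all
preimages are nonzero; summing over the fibre gives `n ∣ ord(g) * deg h`, with `deg h` prime to `n`.

If `k > 0`, all finite values are taken at nonzero finite points, so `g` is a polynomial. A
Riemann–Hurwitz count (`exists_unique_multiplicity_not_dvd`) bounds by two the number of roots of
`g` with multiplicity not divisible by `n`. Zero or two such roots would make `n` divide `deg g`,
which is prime to `n`; the one remaining root is `Q`. -/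

/-- The order of vanishing of a rational function at a finite point. -/
noncomputable def ordAt (P : ℂ) (f : RatFunc ℂ) : ℤ :=
  (f.num.rootMultiplicity P : ℤ) - f.denom.rootMultiplicity P

/-- Cross-multiplication with the reduced form: the order can be read off any fraction, reduced or
not. -/
theorem ordAt_div (P : ℂ) {p q : ℂ[X]} (hp : p ≠ 0) (hq : q ≠ 0) :
    ordAt P (algebraMap ℂ[X] (RatFunc ℂ) p / algebraMap ℂ[X] (RatFunc ℂ) q) =
      (p.rootMultiplicity P : ℤ) - q.rootMultiplicity P := by
  set f := algebraMap ℂ[X] (RatFunc ℂ) p / algebraMap ℂ[X] (RatFunc ℂ) q with hf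
  have hf0 : f ≠ 0 := div_ne_zero (algebraMap_ne_zero hp) (algebraMap_ne_zero hq)
  have h : f.num * q = p * f.denom := (num_mul_eq_mul_denom_iff hq).2 hf
  have h' := congrArg (rootMultiplicity P) h
  rw [rootMultiplicity_mul (mul_ne_zero (num_ne_zero hf0) hq),
    rootMultiplicity_mul (mul_ne_zero hp f.denom_ne_zero)] at h'
  unfold ordAt
  omega

theorem ordAt_algebraMap (P : ℂ) (p : ℂ[X]) :
    ordAt P (algebraMap ℂ[X] (RatFunc ℂ) p) = p.rootMultiplicity P := by
  simp [ordAt]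

@[simp]
theorem ordAt_C (P c : ℂ) : ordAt P (C c) = 0 := by
  simp [ordAt]

theorem ordAt_mul (P : ℂ) {f g : RatFunc ℂ} (hf : f ≠ 0) (hg : g ≠ 0) :
    ordAt P (f * g) = ordAt P f + ordAt P g := by
  have h : f * g = algebraMap ℂ[X] (RatFunc ℂ) (f.num * g.num) /
      algebraMap ℂ[X] (RatFunc ℂ) (f.denom * g.denom) := by
    rw [map_mul, map_mul, mul_div_mul_comm, num_div_denom, num_div_denom]
  have hn := mul_ne_zero (num_ne_zero hf) (num_ne_zero hg)
  have hd := mul_ne_zero f.denom_ne_zero g.denom_ne_zero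
  rw [h, ordAt_div P hn hd, rootMultiplicity_mul hn, rootMultiplicity_mul hd]
  simp only [ordAt]
  push_cast
  ring

theorem ordAt_inv (P : ℂ) {f : RatFunc ℂ} (hf : f ≠ 0) : ordAt P f⁻¹ = -ordAt P f := by
  have h := ordAt_mul P hf (inv_ne_zero hf)
  rw [mul_inv_cancel₀ hf, ← map_one C, ordAt_C] at h
  omega

theorem ordAt_pow (P : ℂ) {f : RatFunc ℂ} (hf : f ≠ 0) (n : ℕ) :
    ordAt P (f ^ n) = n * ordAt P f := by
  induction n with
  | zero => rw [pow_zero, ← map_one C, ordAt_C]; simp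
  | succ n ih => rw [pow_succ, ordAt_mul P (pow_ne_zero n hf) hf, ih]; push_cast; ring

theorem ordAt_zpow (P : ℂ) {f : RatFunc ℂ} (hf : f ≠ 0) (n : ℤ) :
    ordAt P (f ^ n) = n * ordAt P f := by
  obtain ⟨m, rfl | rfl⟩ := n.eq_nat_or_neg
  · rw [zpow_natCast, ordAt_pow P hf]
  · rw [zpow_neg, zpow_natCast, ordAt_inv P (pow_ne_zero m hf), ordAt_pow P hf]; ring

theorem intDegree_pow {f : RatFunc ℂ} (hf : f ≠ 0) (n : ℕ) :
    (f ^ n).intDegree = n * f.intDegree := by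
  induction n with
  | zero => simp
  | succ n ih => rw [pow_succ, intDegree_mul (pow_ne_zero n hf) hf, ih]; push_cast; ring

theorem intDegree_zpow {f : RatFunc ℂ} (hf : f ≠ 0) (n : ℤ) :
    (f ^ n).intDegree = n * f.intDegree := by
  obtain ⟨m, rfl | rfl⟩ := n.eq_nat_or_neg
  · rw [zpow_natCast, intDegree_pow hf]
  · rw [zpow_neg, zpow_natCast, intDegree_inv, intDegree_pow hf]; ring

theorem ordAt_X_sub_C_self (P : ℂ) : ordAt P (X - C P) = 1 := by
  rw [← algebraMap_X, ← algebraMap_C, ← map_sub, ordAt_algebraMap, rootMultiplicity_X_sub_C_self]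
  rfl

theorem ordAt_X_sub_C_of_ne {P Q : ℂ} (h : P ≠ Q) : ordAt P (X - C Q) = 0 := by
  rw [← algebraMap_X, ← algebraMap_C, ← map_sub, ordAt_algebraMap, rootMultiplicity_X_sub_C,
    if_neg h]
  rfl

theorem X_sub_C_ne_zero' (q : ℂ) : (X - C q : RatFunc ℂ) ≠ 0 := by
  rw [← algebraMap_X, ← algebraMap_C, ← map_sub]
  exact algebraMap_ne_zero (Polynomial.X_sub_C_ne_zero q)

theorem intDegree_X_sub_C (q : ℂ) : (X - C q : RatFunc ℂ).intDegree = 1 := by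
  rw [← algebraMap_X, ← algebraMap_C, ← map_sub, intDegree_polynomial, natDegree_X_sub_C]
  rfl

/-- The nonzero rational functions are generated multiplicatively by the nonzero constants and
the `X - q`. -/
theorem induction_linear_factors {motive : RatFunc ℂ → Prop}
    (const : ∀ c, c ≠ 0 → motive (C c)) (linear : ∀ q, motive (X - C q))
    (mul : ∀ f g, f ≠ 0 → g ≠ 0 → motive f → motive g → motive (f * g))
    (inv : ∀ f, f ≠ 0 → motive f → motive f⁻¹) (f : RatFunc ℂ) (hf : f ≠ 0) : motive f := by
  have hpoly : ∀ p : ℂ[X], p ≠ 0 → motive (algebraMap ℂ[X] (RatFunc ℂ) p) := by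
    intro p hp
    have hprod : ∀ s : Multiset ℂ, motive (algebraMap ℂ[X] (RatFunc ℂ)
        ((s.map fun a => Polynomial.X - Polynomial.C a).prod)) := by
      intro s
      induction s using Multiset.induction_on with
      | empty => simpa using const 1 one_ne_zero
      | cons a s ih =>
        rw [Multiset.map_cons, Multiset.prod_cons, map_mul]
        refine mul _ _ ?_ ?_ ?_ ih
        · exact algebraMap_ne_zero (Polynomial.X_sub_C_ne_zero a)
        · exact algebraMap_ne_zero (monic_multiset_prod_of_monic _ _
            fun a _ => Polynomial.monic_X_sub_C a).ne_zero
        · simpa using linear a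
    rw [(IsAlgClosed.splits p).eq_prod_roots, map_mul]
    refine mul _ _ ?_ ?_ ?_ (hprod _)
    · simpa using hp
    · exact algebraMap_ne_zero (monic_multiset_prod_of_monic _ _
            fun a _ => Polynomial.monic_X_sub_C a).ne_zero
    · simpa using const _ (leadingCoeff_ne_zero.2 hp)
  rw [← num_div_denom f, div_eq_mul_inv]
  have h1 := algebraMap_ne_zero (num_ne_zero hf)
  have h2 := algebraMap_ne_zero f.denom_ne_zero
  exact mul _ _ h1 (inv_ne_zero h2) (hpoly _ (num_ne_zero hf)) (inv _ h2 (hpoly _ f.denom_ne_zero))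

end RatFunc

/-! ### Composition as a homomorphism of function fields. -/

open RatFunc

/-- An endomorphism over `ℂ` is determined by the image of `X`. Identities about composition thus
reduce to multiplicativity and additivity of homomorphisms. -/
theorem AlgHom.apply_eq_ratComp (φ : RatFunc ℂ →ₐ[ℂ] RatFunc ℂ) (g : RatFunc ℂ) :
    φ g = ratComp g (φ RatFunc.X) := by
  have key : ∀ p : ℂ[X], φ (algebraMap ℂ[X] (RatFunc ℂ) p) =
      p.eval₂ RatFunc.C (φ RatFunc.X) := by
    intro p
    rw [← aeval_X_left_eq_algebraMap, ← Polynomial.aeval_algHom_apply]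
    rfl
  conv_lhs => rw [← num_div_denom g, map_div₀, key, key]
  rfl

/-- Substitution of a nonconstant rational function, as an algebra homomorphism. -/
noncomputable def compHom (h : RatFunc ℂ) (hh : ¬∃ c, h = RatFunc.C c) :
    RatFunc ℂ →ₐ[ℂ] RatFunc ℂ :=
  liftAlgHom (Polynomial.aeval h) <| nonZeroDivisors_le_comap_nonZeroDivisors_of_injective _ <|
    transcendental_iff_injective.1 (h.transcendental_of_ne_C hh)

theorem compHom_X (h : RatFunc ℂ) (hh : ¬∃ c, h = RatFunc.C c) : compHom h hh RatFunc.X = h := by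
  rw [compHom, ← algebraMap_X, ← div_one (algebraMap ℂ[X] (RatFunc ℂ) Polynomial.X),
    ← map_one (algebraMap ℂ[X] (RatFunc ℂ)), liftAlgHom_apply_div]
  simp

theorem compHom_apply (h : RatFunc ℂ) (hh : ¬∃ c, h = RatFunc.C c) (g : RatFunc ℂ) :
    compHom h hh g = ratComp g h := by
  rw [AlgHom.apply_eq_ratComp, compHom_X]

theorem compHom_C (h : RatFunc ℂ) (hh : ¬∃ c, h = RatFunc.C c) (c : ℂ) :
    compHom h hh (RatFunc.C c) = RatFunc.C c :=
  (compHom h hh).commutes c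

theorem ratComp_X (g : RatFunc ℂ) : ratComp g RatFunc.X = g :=
  (AlgHom.apply_eq_ratComp (AlgHom.id ℂ _) g).symm

/-- Both sides are the value at `g` of one composite homomorphism; nonconstancy is what makes each
substitution a homomorphism. -/
theorem ratComp_ratComp (g m h : RatFunc ℂ) (hm : ¬∃ c, m = RatFunc.C c)
    (hh : ¬∃ c, h = RatFunc.C c) : ratComp (ratComp g m) h = ratComp g (ratComp m h) := by
  have := AlgHom.apply_eq_ratComp ((compHom h hh).comp (compHom m hm)) g
  rwa [AlgHom.comp_apply, AlgHom.comp_apply, compHom_X, compHom_apply, compHom_apply,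
    compHom_apply] at this

/-! ### Orders of a composition: order of the outer function times local multiplicity. -/

namespace RatFunc

theorem sub_C_ne_zero {h : RatFunc ℂ} (hh : ¬∃ c, h = C c) (q : ℂ) : h - C q ≠ 0 :=
  fun e => hh ⟨q, sub_eq_zero.1 e⟩

theorem sub_C_eq_div (h : RatFunc ℂ) (q : ℂ) :
    h - C q = algebraMap ℂ[X] (RatFunc ℂ) (h.num - Polynomial.C q * h.denom) /
      algebraMap ℂ[X] (RatFunc ℂ) h.denom := by
  rw [map_sub, map_mul, algebraMap_C, sub_div, num_div_denom,
    mul_div_cancel_right₀ _ (algebraMap_ne_zero h.denom_ne_zero)]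

theorem num_sub_C_mul_denom_ne_zero {h : RatFunc ℂ} (hh : ¬∃ c, h = C c) (q : ℂ) :
    h.num - Polynomial.C q * h.denom ≠ 0 := by
  intro e
  apply sub_C_ne_zero hh q
  rw [sub_C_eq_div, e]
  simp

theorem ordAt_sub_C {h : RatFunc ℂ} (hh : ¬∃ c, h = C c) (P q : ℂ) :
    ordAt P (h - C q) = ((h.num - Polynomial.C q * h.denom).rootMultiplicity P : ℤ) -
      h.denom.rootMultiplicity P := by
  rw [sub_C_eq_div, ordAt_div P (num_sub_C_mul_denom_ne_zero hh q) h.denom_ne_zero]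

theorem eval_num_ne_zero_of_eval_denom_eq_zero {h : RatFunc ℂ} {P : ℂ}
    (hP : h.denom.eval P = 0) : h.num.eval P ≠ 0 := by
  intro hn
  obtain ⟨a, b, hab⟩ := h.isCoprime_num_denom
  have := congrArg (Polynomial.eval P) hab
  simp [hP, hn] at this

theorem ordAt_sub_C_of_pole {h : RatFunc ℂ} (hh : ¬∃ c, h = C c) {P : ℂ}
    (hP : h.denom.eval P = 0) (q : ℂ) :
    ordAt P (h - C q) = -(h.denom.rootMultiplicity P : ℤ) := by
  rw [ordAt_sub_C hh, rootMultiplicity_eq_zero, Nat.cast_zero, zero_sub]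
  simpa [IsRoot, hP] using eval_num_ne_zero_of_eval_denom_eq_zero hP

theorem ordAt_sub_C_of_eval_ne {h : RatFunc ℂ} (hh : ¬∃ c, h = C c) {P q q' : ℂ}
    (hP : h.denom.eval P ≠ 0) (hq : (h.num - Polynomial.C q * h.denom).eval P = 0)
    (hne : q' ≠ q) : ordAt P (h - C q') = 0 := by
  rw [ordAt_sub_C hh, rootMultiplicity_eq_zero (x := P) (p := h.denom) hP, rootMultiplicity_eq_zero]
  · rfl
  · intro h'
    simp only [IsRoot, eval_sub, Polynomial.eval_mul, Polynomial.eval_C] at h' hq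
    have : (q' - q) * h.denom.eval P = 0 := by linear_combination hq - h'
    rcases mul_eq_zero.1 this with e | e
    · exact hne (sub_eq_zero.1 e)
    · exact hP e

/-- Orders of a composition at a pole of the inner function. -/
theorem ordAt_ratComp_of_pole {h : RatFunc ℂ} (hh : ¬∃ c, h = C c) {P : ℂ}
    (hP : h.denom.eval P = 0) {g : RatFunc ℂ} (hg : g ≠ 0) :
    ordAt P (ratComp g h) = -(g.intDegree * h.denom.rootMultiplicity P) := by
  rw [← compHom_apply h hh]
  refine induction_linear_factors
    (motive := fun g => ordAt P (compHom h hh g) = -(g.intDegree * h.denom.rootMultiplicity P))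
    ?_ ?_ ?_ ?_ g hg
  · intro c _; simp [compHom_C]
  · intro q
    rw [map_sub, compHom_X, compHom_C, ordAt_sub_C_of_pole hh hP, intDegree_X_sub_C, one_mul]
  · intro f g hf hg ihf ihg
    rw [map_mul, ordAt_mul P (by simpa using hf) (by simpa using hg), ihf, ihg,
      intDegree_mul hf hg]
    ring
  · intro f hf ih
    rw [map_inv₀, ordAt_inv P (by simpa using hf), ih, intDegree_inv]
    ring

/-- Orders of a composition at a point where the inner function takes the finite value `Q`. -/
theorem ordAt_ratComp_of_eval {h : RatFunc ℂ} (hh : ¬∃ c, h = C c) {P Q : ℂ}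
    (hQ : (h.num - Polynomial.C Q * h.denom).eval P = 0) {g : RatFunc ℂ} (hg : g ≠ 0) :
    ordAt P (ratComp g h) =
      ordAt Q g * (h.num - Polynomial.C Q * h.denom).rootMultiplicity P := by
  have hP : h.denom.eval P ≠ 0 := by
    intro hP
    have := eval_num_ne_zero_of_eval_denom_eq_zero hP
    simp [hP, this] at hQ
  rw [← compHom_apply h hh]
  refine induction_linear_factors
    (motive := fun g => ordAt P (compHom h hh g) =
      ordAt Q g * (h.num - Polynomial.C Q * h.denom).rootMultiplicity P)
    ?_ ?_ ?_ ?_ g hg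
  · intro c _; simp [compHom_C]
  · intro q
    rw [map_sub, compHom_X, compHom_C]
    rcases eq_or_ne q Q with rfl | hne
    · rw [ordAt_X_sub_C_self, ordAt_sub_C hh, rootMultiplicity_eq_zero (p := h.denom) hP]
      simp
    · rw [ordAt_X_sub_C_of_ne hne.symm, ordAt_sub_C_of_eval_ne hh hP hQ hne, zero_mul]
  · intro f g hf hg ihf ihg
    rw [map_mul, ordAt_mul P (by simpa using hf) (by simpa using hg), ihf, ihg,
      ordAt_mul Q hf hg]
    ring
  · intro f hf ih
    rw [map_inv₀, ordAt_inv P (by simpa using hf), ih, ordAt_inv Q hf]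
    ring

theorem not_const_of_intDegree_ne_zero {h : RatFunc ℂ} (hd : h.intDegree ≠ 0) :
    ¬∃ c, h = C c := by
  rintro ⟨c, rfl⟩
  simp at hd

theorem natDegree_num_sub_C_mul_denom {h : RatFunc ℂ} (hd : 0 < h.intDegree) (q : ℂ) :
    (h.num - Polynomial.C q * h.denom).natDegree = h.num.natDegree := by
  apply natDegree_sub_eq_left_of_natDegree_lt
  refine (natDegree_C_mul_le _ _).trans_lt ?_
  unfold intDegree at hd
  omega

/-- The counterpart at infinity of the local formulas: `h` maps `∞` to `∞` with multiplicity
`h.intDegree`. -/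
theorem intDegree_ratComp {h : RatFunc ℂ} (hd : 0 < h.intDegree) {g : RatFunc ℂ} (hg : g ≠ 0) :
    (ratComp g h).intDegree = g.intDegree * h.intDegree := by
  have hh := not_const_of_intDegree_ne_zero hd.ne'
  rw [← compHom_apply h hh]
  refine induction_linear_factors
    (motive := fun g => (compHom h hh g).intDegree = g.intDegree * h.intDegree)
    ?_ ?_ ?_ ?_ g hg
  · intro c _; simp [compHom_C]
  · intro q
    rw [map_sub, compHom_X, compHom_C, intDegree_X_sub_C, sub_C_eq_div, intDegree_div
      (algebraMap_ne_zero (num_sub_C_mul_denom_ne_zero hh q)) (algebraMap_ne_zero h.denom_ne_zero),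
      intDegree_polynomial, intDegree_polynomial, natDegree_num_sub_C_mul_denom hd, one_mul]
    rfl
  · intro f g hf hg ihf ihg
    rw [map_mul, intDegree_mul (by simpa using hf) (by simpa using hg), ihf, ihg,
      intDegree_mul hf hg]
    ring
  · intro f hf ih
    rw [map_inv₀, intDegree_inv, ih, intDegree_inv]
    ring

end RatFunc

/-! ### Ramification count for `a / X ^ k`. -/

namespace Polynomial

/-- Over `ℂ`, a polynomial all of whose root multiplicities are divisible by `m` is an `m`-th
power. -/
theorem exists_eq_pow_of_dvd_rootMultiplicity {s : ℂ[X]} {m : ℕ} (hm : 0 < m)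
    (h : ∀ P, m ∣ s.rootMultiplicity P) : ∃ S : ℂ[X], s = S ^ m := by
  obtain ⟨c, hc⟩ := IsAlgClosed.exists_pow_nat_eq s.leadingCoeff hm
  refine ⟨C c * ∏ a ∈ s.roots.toFinset, (X - C a) ^ (s.rootMultiplicity a / m), ?_⟩
  conv_lhs => rw [(IsAlgClosed.splits s).eq_prod_roots]
  rw [mul_pow, ← C_pow, hc, ← Finset.prod_pow, Finset.prod_multiset_map_count]
  congr 1
  refine Finset.prod_congr rfl fun a _ => ?_
  rw [← pow_mul, Nat.div_mul_cancel (h a), count_roots]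

theorem natDegree_eq_sum_rootMultiplicity (s : ℂ[X]) :
    s.natDegree = ∑ a ∈ s.roots.toFinset, s.rootMultiplicity a := by
  rw [(IsAlgClosed.splits s).natDegree_eq_card_roots, ← Multiset.toFinset_sum_count_eq]
  exact Finset.sum_congr rfl fun a _ => count_roots s

/-- Let `h = a / X ^ k` have poles exactly at `0` and `∞`. If every multiplicity of every zero of
`h - Q`, times the multiplicity of `Q` in `u`, is divisible by `n`, and the degree of `u` is prime
to `n`, then exactly one `Q` has a multiplicity in `u` that is not divisible by `n`. -/
theorem exists_unique_multiplicity_not_dvd {n : ℕ} (hn : 1 < n) {u a : ℂ[X]} {k : ℕ}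
    (hk : 0 < k) (hka : k < a.natDegree) (ha : a.eval 0 ≠ 0)
    (hcop : n.Coprime u.natDegree)
    (h : ∀ Q P, n ∣ u.rootMultiplicity Q * (a - C Q * X ^ k).rootMultiplicity P) :
    ∃ Q, (∀ Q', Q' ≠ Q → n ∣ u.rootMultiplicity Q') ∧
      ∀ P, n ∣ (a - C Q * X ^ k).rootMultiplicity P := by
  classical
  set N := a.natDegree with hN
  let A : ℂ → ℂ[X] := fun Q => a - C Q * X ^ k
  have hAdeg : ∀ Q, (A Q).natDegree = N := fun Q =>
    natDegree_sub_eq_left_of_natDegree_lt ((natDegree_C_mul_X_pow_le Q k).trans_lt hka)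
  have hA0 : ∀ Q, A Q ≠ 0 := fun Q e => by
    have := hAdeg Q
    rw [e, natDegree_zero] at this
    omega
  have hAX : ∀ Q, IsCoprime (A Q) (X ^ k) := by
    intro Q
    refine IsCoprime.pow_right ((Irreducible.coprime_iff_not_dvd irreducible_X).2 ?_).symm
    rw [X_dvd_iff, coeff_zero_eq_eval_zero]
    simpa [A, hk.ne'] using ha
  have hAA : ∀ Q Q', Q ≠ Q' → IsCoprime (A Q) (A Q') := by
    intro Q Q' hne
    have e : A Q' = C (Q - Q') * X ^ k + A Q * 1 := by simp only [A, C_sub]; ring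
    rw [e]
    apply IsCoprime.add_mul_left_right
    rw [isCoprime_mul_unit_left_right]
    · exact hAX Q
    · exact isUnit_C.2 (sub_ne_zero.2 hne).isUnit
  -- `W / X ^ (k + 1)` is the derivative of `a / X ^ k`. It does not change when a constant `Q` is
  -- subtracted, so one `W` records the ramification over all `Q`.
  set W : ℂ[X] := X * derivative a - C (k : ℂ) * a with hW
  have hWA : ∀ Q, W = X * derivative (A Q) - C (k : ℂ) * A Q := by
    intro Q
    have : (X : ℂ[X]) ^ k = X * X ^ (k - 1) := by rw [← pow_succ', Nat.sub_add_cancel hk]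
    simp only [A, hW, derivative_sub, derivative_C_mul, derivative_X_pow]
    rw [this, Polynomial.C_eq_natCast]
    ring
  -- The top terms of `X * a'` and `k * a` do not cancel because `k < N`; this serves to show `W ≠
  -- 0`.
  have hWcoeff : W.coeff N ≠ 0 := by
    have : W.coeff N = ((N : ℂ) - k) * a.leadingCoeff := by
      obtain ⟨M, hM⟩ : ∃ M, N = M + 1 := ⟨N - 1, by omega⟩
      rw [hW, coeff_sub, coeff_C_mul, leadingCoeff, ← hN, hM, coeff_X_mul, coeff_derivative]
      push_cast
      ring
    rw [this]
    refine mul_ne_zero (sub_ne_zero.2 ?_) (leadingCoeff_ne_zero.2 ?_)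
    · exact_mod_cast hka.ne'
    · rintro rfl; simp at ha
  have hW0 : W ≠ 0 := fun e => hWcoeff (by rw [e, coeff_zero])
  have hWdeg : W.natDegree ≤ N := by
    refine (natDegree_sub_le _ _).trans (max_le ?_ (natDegree_C_mul_le _ _))
    refine natDegree_mul_le.trans ?_
    have := natDegree_derivative_le a
    rw [natDegree_X]
    omega
  -- The part of `n` that the multiplicity of `Q` in `u` does not supply; it must divide every
  -- multiplicity of `A Q`, so `A Q` is an `m Q`-th power.
  let m : ℂ → ℕ := fun Q => n / n.gcd (u.rootMultiplicity Q)
  have hmul : ∀ Q, m Q * n.gcd (u.rootMultiplicity Q) = n := fun Q =>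
    Nat.div_mul_cancel (Nat.gcd_dvd_left _ _)
  have hm0 : ∀ Q, 0 < m Q := fun Q => Nat.pos_of_ne_zero fun e => by
    have := hmul Q
    rw [e] at this
    omega
  have hmdvd : ∀ Q P, m Q ∣ (A Q).rootMultiplicity P := fun Q P => by
    have hg : 0 < n.gcd (u.rootMultiplicity Q) := Nat.gcd_pos_of_pos_left _ (by omega)
    refine (Nat.coprime_div_gcd_div_gcd hg).dvd_of_dvd_mul_left ?_
    refine Nat.dvd_of_mul_dvd_mul_right hg ?_
    rw [hmul, mul_right_comm, Nat.div_mul_cancel (Nat.gcd_dvd_right _ _)]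
    exact h Q P
  choose S hS using fun Q => exists_eq_pow_of_dvd_rootMultiplicity (hm0 Q) (hmdvd Q)
  have hS0 : ∀ Q, S Q ≠ 0 := fun Q e => hA0 Q (by rw [hS, e, zero_pow (hm0 Q).ne'])
  have hSdeg : ∀ Q, m Q * (S Q).natDegree = N := fun Q => by
    rw [← hAdeg Q, hS Q, natDegree_pow]
  have hSW : ∀ Q, S Q ^ (m Q - 1) ∣ W := by
    intro Q
    rw [hWA Q, hS Q, derivative_pow]
    have e : S Q ^ m Q = S Q ^ (m Q - 1) * S Q := by
      rw [← pow_succ, Nat.sub_add_cancel (hm0 Q)]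
    rw [e]
    exact ⟨X * (C (m Q : ℂ) * derivative (S Q)) - C (k : ℂ) * S Q, by ring⟩
  set T := u.roots.toFinset.filter fun Q => ¬ n ∣ u.rootMultiplicity Q with hT
  have hTmem : ∀ Q, Q ∈ T ↔ ¬ n ∣ u.rootMultiplicity Q := by
    intro Q
    rw [hT, Finset.mem_filter, Multiset.mem_toFinset, and_iff_right_iff_imp]
    intro hQ
    rw [← Multiset.count_pos, count_roots]
    exact Nat.pos_of_ne_zero fun e => hQ (by rw [e]; exact dvd_zero n)
  have hm2 : ∀ Q ∈ T, 2 ≤ m Q := by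
    intro Q hQ
    rw [hTmem] at hQ
    by_contra hlt
    have h1 : m Q = 1 := by have := hm0 Q; omega
    have := hmul Q
    rw [h1, one_mul] at this
    exact hQ (Nat.gcd_eq_left_iff_dvd.1 this)
  -- The factors `S Q ^ (m Q - 1)` of `W` are pairwise coprime, so their product divides `W`, of
  -- degree at most `N`. As `(m - 1) / m ≥ 1 / 2` on `T`, each contributes at least `N / 2`.
  have hdegsum : ∑ Q ∈ T, (m Q - 1) * (S Q).natDegree ≤ N := by
    have hdvd : ∏ Q ∈ T, S Q ^ (m Q - 1) ∣ W := by
      refine Finset.prod_dvd_of_coprime (fun Q _ Q' _ hne => ?_) fun Q _ => hSW Q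
      have := hAA Q Q' hne
      rw [hS Q, hS Q'] at this
      exact ((IsCoprime.pow_iff (hm0 Q) (hm0 Q')).1 this).pow
    have := natDegree_le_of_dvd hdvd hW0
    rw [natDegree_prod _ _ fun Q _ => pow_ne_zero _ (hS0 Q)] at this
    simp only [natDegree_pow] at this
    exact this.trans hWdeg
  have hterm : ∀ Q ∈ T, N ≤ 2 * ((m Q - 1) * (S Q).natDegree) := by
    intro Q hQ
    obtain ⟨t, ht⟩ : ∃ t, m Q = t + 2 := ⟨m Q - 2, by have := hm2 Q hQ; omega⟩
    have := hSdeg Q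
    rw [ht] at this ⊢
    rw [← this, show t + 2 - 1 = t + 1 by omega]
    nlinarith [Nat.zero_le (t * (S Q).natDegree)]
  have hcard : T.card ≤ 2 := by
    have h1 := Finset.card_nsmul_le_sum T _ N hterm
    rw [← Finset.mul_sum, smul_eq_mul] at h1
    by_contra hlt
    have : 3 * N ≤ T.card * N := Nat.mul_le_mul_right _ (by omega)
    omega
  have hsum : u.natDegree = ∑ Q ∈ T, u.rootMultiplicity Q +
      ∑ Q ∈ u.roots.toFinset with ¬ ¬ n ∣ u.rootMultiplicity Q, u.rootMultiplicity Q := by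
    rw [natDegree_eq_sum_rootMultiplicity, hT, Finset.sum_filter_add_sum_filter_not]
  have hrest : n ∣ ∑ Q ∈ u.roots.toFinset with ¬ ¬ n ∣ u.rootMultiplicity Q,
      u.rootMultiplicity Q :=
    Finset.dvd_sum fun Q hQ => not_not.1 (Finset.mem_filter.1 hQ).2
  have hcop' : n.Coprime (∑ Q ∈ T, u.rootMultiplicity Q) := by
    obtain ⟨c, hc⟩ := hrest
    rw [hsum, hc] at hcop
    simpa using hcop
  have hne : ¬ n ∣ ∑ Q ∈ T, u.rootMultiplicity Q := fun hd =>
    hn.ne' (Nat.Coprime.eq_one_of_dvd hcop' hd)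
  obtain hc | hc | hc : T.card = 0 ∨ T.card = 1 ∨ T.card = 2 := by omega
  · rw [Finset.card_eq_zero.1 hc] at hne
    simp at hne
  · obtain ⟨Q, hQ⟩ := Finset.card_eq_one.1 hc
    refine ⟨Q, fun Q' hQ' => ?_, fun P => ?_⟩
    · by_contra hnd
      rw [← hTmem, hQ, Finset.mem_singleton] at hnd
      exact hQ' hnd
    · rw [hQ, Finset.sum_singleton] at hcop'
      exact hcop'.dvd_of_dvd_mul_left (h Q P)
  · exfalso
    obtain ⟨Q₁, Q₂, h12, hQ⟩ := Finset.card_eq_two.1 hc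
    have mem1 : Q₁ ∈ T := by simp [hQ]
    have mem2 : Q₂ ∈ T := by simp [hQ]
    rw [hQ, Finset.sum_pair h12] at hdegsum
    have t1 := hterm Q₁ mem1
    have t2 := hterm Q₂ mem2
    -- With two elements in `T` every inequality is an equality, so `m Q = 2` and the multiplicity
    -- of `Q` is an odd multiple of `n / 2`. Two of these add up to a multiple of `n`.
    have htwo : ∀ Q ∈ T, 2 * ((m Q - 1) * (S Q).natDegree) = N →
        ∃ w, 2 * u.rootMultiplicity Q = n * (2 * w + 1) := by
      intro Q hQT hQN
      have hd := hSdeg Q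
      have hm := hm2 Q hQT
      have hs : 0 < (S Q).natDegree := Nat.pos_of_ne_zero fun e => by
        rw [e, mul_zero] at hd; omega
      have hmQ : m Q = 2 := by
        have : 2 * (m Q - 1) = m Q := Nat.eq_of_mul_eq_mul_right hs (by rw [hd, mul_assoc, hQN])
        omega
      have hg := hmul Q
      rw [hmQ] at hg
      obtain ⟨v, hv⟩ := Nat.gcd_dvd_right n (u.rootMultiplicity Q)
      rcases Nat.even_or_odd' v with ⟨w, hw | hw⟩
      · refine absurd ⟨w, ?_⟩ ((hTmem Q).1 hQT)
        rw [hv, hw]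
        conv_rhs => rw [← hg]
        ring
      · refine ⟨w, ?_⟩
        rw [← hw]
        conv_lhs => rw [hv]
        conv_rhs => rw [← hg]
        ring
    obtain ⟨w₁, hw₁⟩ := htwo Q₁ mem1 (by omega)
    obtain ⟨w₂, hw₂⟩ := htwo Q₂ mem2 (by omega)
    apply hne
    rw [hQ, Finset.sum_pair h12]
    exact ⟨w₁ + w₂ + 1, by linarith⟩

end Polynomial

/-! ### From orders to the form `x^i G^n`, and the choice of `Q`. -/

namespace RatFunc

theorem denom_eq_X_pow {h : RatFunc ℂ} (hP : ∀ P, P ≠ 0 → h.denom.eval P ≠ 0) :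
    h.denom = Polynomial.X ^ (h.denom.roots.card) := by
  have hr : h.denom.roots = Multiset.replicate h.denom.roots.card 0 := by
    refine Multiset.eq_replicate_card.2 fun b hb => ?_
    by_contra hb0
    exact hP b hb0 (isRoot_of_mem_roots hb)
  conv_lhs => rw [(IsAlgClosed.splits h.denom).eq_prod_roots_of_monic h.monic_denom, hr]
  simp

theorem ordAt_eq_neg_of_eval_denom_eq_zero {h : RatFunc ℂ} {P : ℂ} (hP : h.denom.eval P = 0) :
    ordAt P h = -(h.denom.rootMultiplicity P : ℤ) := by
  rw [ordAt, rootMultiplicity_eq_zero, Nat.cast_zero, zero_sub]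
  exact eval_num_ne_zero_of_eval_denom_eq_zero hP

theorem denom_eq_one_of_ordAt_nonneg {g : RatFunc ℂ} (h : ∀ P, 0 ≤ ordAt P g) : g.denom = 1 := by
  refine (g.monic_denom.natDegree_eq_zero).1 ?_
  by_contra hd
  obtain ⟨P, hP⟩ := IsAlgClosed.exists_root g.denom fun e =>
    hd (natDegree_eq_zero_iff_degree_le_zero.2 e.le)
  have h1 := h P
  have h2 := (rootMultiplicity_pos g.denom_ne_zero).2 hP
  rw [ordAt_eq_neg_of_eval_denom_eq_zero hP] at h1
  omega

theorem eq_algebraMap_num {g : RatFunc ℂ} (h : g.denom = 1) :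
    g = algebraMap ℂ[X] (RatFunc ℂ) g.num := by
  conv_lhs => rw [← num_div_denom g, h, map_one, div_one]

/-- A rational function whose orders at the nonzero finite points are nonnegative multiples of
`n` is a power of `x` times the `n`-th power of a polynomial. -/
theorem exists_eq_zpow_mul_pow {n : ℕ} (hn : 0 < n) {f : RatFunc ℂ} (hf : f ≠ 0)
    (h : ∀ P, P ≠ 0 → 0 ≤ ordAt P f ∧ (n : ℤ) ∣ ordAt P f) :
    ∃ (i : ℤ) (G : ℂ[X]), f = X ^ i * algebraMap ℂ[X] (RatFunc ℂ) G ^ n := by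
  set g := X ^ (-ordAt 0 f) * f with hg
  have hXne : (X : RatFunc ℂ) ≠ 0 := X_ne_zero
  have hX : ∀ P : ℂ, P ≠ 0 → ordAt P X = 0 := fun P hP => by
    simpa using ordAt_X_sub_C_of_ne hP
  have hX0 : ordAt 0 X = 1 := by simpa using ordAt_X_sub_C_self 0
  have hord : ∀ P, 0 ≤ ordAt P g ∧ (n : ℤ) ∣ ordAt P g := by
    intro P
    rw [hg, ordAt_mul P (zpow_ne_zero _ hXne) hf, ordAt_zpow P hXne]
    rcases eq_or_ne P 0 with rfl | hP
    · simp [hX0]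
    · simpa [hX P hP] using h P hP
  have hden := denom_eq_one_of_ordAt_nonneg fun P => (hord P).1
  obtain ⟨G, hG⟩ := exists_eq_pow_of_dvd_rootMultiplicity (s := g.num) hn fun P => by
    have := (hord P).2
    rw [eq_algebraMap_num hden, ordAt_algebraMap] at this
    exact_mod_cast this
  refine ⟨ordAt 0 f, G, ?_⟩
  rw [← map_pow, ← hG, ← eq_algebraMap_num hden, hg, ← mul_assoc, ← zpow_add₀ hXne]
  simp

theorem exists_root_num_sub_C_mul_denom {h : RatFunc ℂ} (hd : 0 < h.intDegree) (Q : ℂ) :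
    ∃ P, (h.num - Polynomial.C Q * h.denom).eval P = 0 := by
  refine IsAlgClosed.exists_root _ fun e => ?_
  have := natDegree_eq_zero_iff_degree_le_zero.2 e.le
  rw [natDegree_num_sub_C_mul_denom hd] at this
  unfold intDegree at hd
  omega

/-- The case of `exists_translate` where the inner function is a polynomial. -/
theorem exists_translate_of_polynomial {n : ℕ} {g h : RatFunc ℂ} (hg : g ≠ 0)
    (hd : 0 < h.intDegree) (hfd : IsCoprime (n : ℤ) (ratComp g h).intDegree)
    (hf0 : IsCoprime (n : ℤ) (ordAt 0 (ratComp g h)))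
    (hf : ∀ P, P ≠ 0 → 0 ≤ ordAt P (ratComp g h) ∧ (n : ℤ) ∣ ordAt P (ratComp g h))
    (hden : h.denom = 1) :
    ∃ Q, (∀ P, P ≠ 0 → 0 ≤ ordAt P (h - C Q) ∧ (n : ℤ) ∣ ordAt P (h - C Q)) ∧
      ∀ Q', Q' ≠ Q → 0 ≤ ordAt Q' g ∧ (n : ℤ) ∣ ordAt Q' g := by
  have hh := not_const_of_intDegree_ne_zero hd.ne'
  rw [intDegree_ratComp hd hg] at hfd
  refine ⟨h.num.eval 0, fun P hP => ?_, fun Q' hQ' => ?_⟩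
  · set Q := h.num.eval 0 with hQ
    rw [ordAt_sub_C hh, rootMultiplicity_eq_zero (p := h.denom) (by simp [hden])]
    simp only [Nat.cast_zero, sub_zero, Nat.cast_nonneg, true_and]
    by_cases hr : (h.num - Polynomial.C Q * h.denom).eval P = 0
    · have h1 := (hf P hP).2
      rw [ordAt_ratComp_of_eval hh hr hg] at h1
      rw [ordAt_ratComp_of_eval hh (Q := Q) (by simp [hden, hQ]) hg] at hf0
      exact hf0.of_mul_right_left.dvd_of_dvd_mul_left h1
    · rw [rootMultiplicity_eq_zero hr]
      simp
  · set s := h.num - Polynomial.C Q' * h.denom with hs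
    have hs0 : s ≠ 0 := num_sub_C_mul_denom_ne_zero hh Q'
    have hne : ∀ P, s.eval P = 0 → P ≠ 0 := by
      rintro P hP rfl
      rw [hs, hden] at hP
      simp only [mul_one, eval_sub, Polynomial.eval_C] at hP
      exact hQ' (sub_eq_zero.1 hP).symm
    constructor
    · obtain ⟨P, hP⟩ := exists_root_num_sub_C_mul_denom hd Q'
      have h1 := (hf P (hne P hP)).1
      rw [ordAt_ratComp_of_eval hh hP hg] at h1
      exact nonneg_of_mul_nonneg_left h1
        (by exact_mod_cast (rootMultiplicity_pos hs0).2 hP)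
    -- The multiplicities over `Q'` add up to `deg h`, and `n` divides each of them times `ordAt Q'
    -- g`.
    · have hdeg : h.intDegree = ∑ P ∈ s.roots.toFinset, (s.rootMultiplicity P : ℤ) := by
        rw [intDegree, hden, natDegree_one, Nat.cast_zero, sub_zero,
          ← natDegree_num_sub_C_mul_denom hd Q', ← hs, natDegree_eq_sum_rootMultiplicity]
        push_cast
        rfl
      refine hfd.of_mul_right_right.dvd_of_dvd_mul_right ?_
      rw [hdeg, Finset.mul_sum]
      refine Finset.dvd_sum fun P hP => ?_
      have hr : s.eval P = 0 := isRoot_of_mem_roots (Multiset.mem_toFinset.1 hP)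
      rw [← ordAt_ratComp_of_eval hh hr hg]
      exact (hf P (hne P hr)).2

/-- The case of `exists_translate` where the inner function has a pole at the origin. -/
theorem exists_translate_of_pole {n : ℕ} (hn : 1 < n) {g h : RatFunc ℂ} (hg : g ≠ 0)
    (hd : 0 < h.intDegree) (hfd : IsCoprime (n : ℤ) (ratComp g h).intDegree)
    (hf : ∀ P, P ≠ 0 → 0 ≤ ordAt P (ratComp g h) ∧ (n : ℤ) ∣ ordAt P (ratComp g h))
    {k : ℕ} (hk : 0 < k) (hden : h.denom = Polynomial.X ^ k) :
    ∃ Q, (∀ P, P ≠ 0 → 0 ≤ ordAt P (h - C Q) ∧ (n : ℤ) ∣ ordAt P (h - C Q)) ∧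
      ∀ Q', Q' ≠ Q → 0 ≤ ordAt Q' g ∧ (n : ℤ) ∣ ordAt Q' g := by
  have hh := not_const_of_intDegree_ne_zero hd.ne'
  have ha : h.num.eval 0 ≠ 0 :=
    eval_num_ne_zero_of_eval_denom_eq_zero (by simp [hden, hk.ne'])
  have hne : ∀ Q P, (h.num - Polynomial.C Q * h.denom).eval P = 0 → P ≠ 0 := by
    rintro Q P hP rfl
    simp [hden, hk.ne'] at hP
    exact ha hP
  -- Every finite `Q` is a value of `h`, and it is taken away from `0`, where `h` has a pole.
  have hgpos : ∀ Q, 0 ≤ ordAt Q g := by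
    intro Q
    obtain ⟨P, hP⟩ := exists_root_num_sub_C_mul_denom hd Q
    have h1 := (hf P (hne Q P hP)).1
    rw [ordAt_ratComp_of_eval hh hP hg] at h1
    exact nonneg_of_mul_nonneg_left h1
      (by exact_mod_cast (rootMultiplicity_pos (num_sub_C_mul_denom_ne_zero hh Q)).2 hP)
  have hgden := denom_eq_one_of_ordAt_nonneg hgpos
  have hgord : ∀ Q, ordAt Q g = g.num.rootMultiplicity Q := fun Q => by
    rw [ordAt, hgden, rootMultiplicity_eq_zero (p := 1) (by simp)]
    simp
  have hgdeg : g.intDegree = g.num.natDegree := by simp [intDegree, hgden]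
  rw [intDegree_ratComp hd hg, hgdeg] at hfd
  obtain ⟨Q, hQ, hQ'⟩ := exists_unique_multiplicity_not_dvd hn (u := g.num) (a := h.num) hk
    (by simp only [intDegree, hden, natDegree_X_pow] at hd; omega) ha
    (Nat.isCoprime_iff_coprime.1 hfd.of_mul_right_left) (fun Q P => by
      rw [← hden]
      by_cases hr : (h.num - Polynomial.C Q * h.denom).eval P = 0
      · have h1 := (hf P (hne Q P hr)).2
        rw [ordAt_ratComp_of_eval hh hr hg, hgord] at h1
        exact_mod_cast h1
      · rw [rootMultiplicity_eq_zero hr]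
        simp)
  refine ⟨Q, fun P hP => ?_, fun Q' hne' => ⟨hgpos Q', ?_⟩⟩
  · rw [ordAt_sub_C hh, rootMultiplicity_eq_zero (p := h.denom) (by simp [hden, hP])]
    simp only [Nat.cast_zero, sub_zero, Nat.cast_nonneg, true_and]
    rw [hden]
    exact_mod_cast hQ' P
  · rw [hgord]
    exact_mod_cast hQ Q' hne'

/-- If `h` and `g ∘ h` have poles at `∞`, and the orders of `g ∘ h` are nonnegative multiples of
`n` except at `0` and `∞`, where they are prime to `n`, then after a translation both `g` and `h`
have orders that are nonnegative multiples of `n` at the nonzero finite points. -/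
theorem exists_translate {n : ℕ} (hn : 1 < n) {g h : RatFunc ℂ} (hg : g ≠ 0)
    (hd : 0 < h.intDegree) (hfpos : 0 < (ratComp g h).intDegree)
    (hfd : IsCoprime (n : ℤ) (ratComp g h).intDegree)
    (hf0 : IsCoprime (n : ℤ) (ordAt 0 (ratComp g h)))
    (hf : ∀ P, P ≠ 0 → 0 ≤ ordAt P (ratComp g h) ∧ (n : ℤ) ∣ ordAt P (ratComp g h)) :
    ∃ Q, (∀ P, P ≠ 0 → 0 ≤ ordAt P (h - C Q) ∧ (n : ℤ) ∣ ordAt P (h - C Q)) ∧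
      ∀ Q', Q' ≠ Q → 0 ≤ ordAt Q' g ∧ (n : ℤ) ∣ ordAt Q' g := by
  have hh := not_const_of_intDegree_ne_zero hd.ne'
  have hgd : 0 < g.intDegree := by
    rw [intDegree_ratComp hd hg] at hfpos
    exact pos_of_mul_pos_left hfpos hd.le
  -- Since `g` has a pole at `∞`, a pole of `h` at a nonzero `P` would be a pole of the composition.
  have hden := denom_eq_X_pow (h := h) fun P hP hP' => by
    have h1 := (hf P hP).1
    rw [ordAt_ratComp_of_pole hh hP' hg] at h1
    have h2 : 0 < (h.denom.rootMultiplicity P : ℤ) := by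
      exact_mod_cast (rootMultiplicity_pos h.denom_ne_zero).2 hP'
    have := mul_pos hgd h2
    omega
  rcases Nat.eq_zero_or_pos h.denom.roots.card with h0 | h0
  · rw [h0, pow_zero] at hden
    exact exists_translate_of_polynomial hg hd hfd hf0 hf hden
  · exact exists_translate_of_pole hn hg hd hfd hf h0 hden

end RatFunc

/-! ### Degree-one changes of variable and the decomposition from orders. -/

open RatFunc

theorem ratDegree_div {p q : ℂ[X]} (hq : q ≠ 0) (h : IsCoprime p q) :
    ratDegree (algebraMap ℂ[X] (RatFunc ℂ) p / algebraMap ℂ[X] (RatFunc ℂ) q) =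
      max p.natDegree q.natDegree := by
  set f := algebraMap ℂ[X] (RatFunc ℂ) p / algebraMap ℂ[X] (RatFunc ℂ) q with hf
  have e : f.num * q = p * f.denom := (num_mul_eq_mul_denom_iff hq).2 hf
  have h1 : Associated f.denom q :=
    associated_of_dvd_dvd
      (f.isCoprime_num_denom.symm.dvd_of_dvd_mul_left ⟨p, by rw [e, mul_comm]⟩)
      (h.symm.dvd_of_dvd_mul_left ⟨f.num, by rw [← e, mul_comm]⟩)
  have h2 : Associated f.num p := by
    obtain ⟨u, hu⟩ := h1
    refine ⟨u, mul_right_cancel₀ f.denom_ne_zero ?_⟩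
    rw [← e, ← hu]
    ring
  rw [ratDegree, natDegree_eq_of_degree_eq (degree_eq_degree_of_associated h1),
    natDegree_eq_of_degree_eq (degree_eq_degree_of_associated h2)]

theorem exists_decomposition_of_translate {n : ℕ} (hn : 0 < n) {g h : RatFunc ℂ} (hg : g ≠ 0)
    (hh : ¬∃ c, h = RatFunc.C c) {Q : ℂ}
    (h1 : ∀ P, P ≠ 0 → 0 ≤ ordAt P (h - RatFunc.C Q) ∧ (n : ℤ) ∣ ordAt P (h - RatFunc.C Q))
    (h2 : ∀ Q', Q' ≠ Q → 0 ≤ ordAt Q' g ∧ (n : ℤ) ∣ ordAt Q' g) :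
    ∃ (i j : ℤ) (G H : ℂ[X]),
      ratComp g (RatFunc.X + RatFunc.C Q) =
        RatFunc.X ^ i * algebraMap ℂ[X] (RatFunc ℂ) G ^ n ∧
      h - RatFunc.C Q = RatFunc.X ^ j * algebraMap ℂ[X] (RatFunc ℂ) H ^ n := by
  obtain ⟨j, H, hH⟩ := exists_eq_zpow_mul_pow hn (sub_C_ne_zero hh Q) h1
  have hpoly : RatFunc.X + RatFunc.C Q = algebraMap ℂ[X] (RatFunc ℂ) (Polynomial.X + Polynomial.C Q) := by simp
  have hdeg : (RatFunc.X + RatFunc.C Q).intDegree = 1 := by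
    rw [hpoly, intDegree_polynomial, natDegree_X_add_C]; rfl
  have hm : ¬∃ c, RatFunc.X + RatFunc.C Q = RatFunc.C c :=
    not_const_of_intDegree_ne_zero (by rw [hdeg]; exact one_ne_zero)
  have hne : ratComp g (RatFunc.X + RatFunc.C Q) ≠ 0 := by
    rw [← compHom_apply _ hm]; simpa using hg
  obtain ⟨i, G, hG⟩ := exists_eq_zpow_mul_pow hn hne fun P hP => by
    -- The translation takes the value `P + Q` at `P` with multiplicity one, so it carries the
    -- orders of `g` over unchanged.
    have hs : (RatFunc.X + RatFunc.C Q).num - Polynomial.C (P + Q) * (RatFunc.X + RatFunc.C Q).denom =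
        Polynomial.X - Polynomial.C P := by
      rw [hpoly, num_algebraMap, denom_algebraMap, C_add]; ring
    rw [ordAt_ratComp_of_eval hm (Q := P + Q) (by rw [hs]; simp) hg, hs,
      rootMultiplicity_X_sub_C_self]
    simpa using h2 (P + Q) (by simpa using hP)
  exact ⟨i, j, G, H, hG, hH⟩

theorem not_const_sub {h : RatFunc ℂ} (hh : ¬∃ c, h = RatFunc.C c) (Q : ℂ) :
    ¬∃ c, h - RatFunc.C Q = RatFunc.C c := by
  rintro ⟨c, hc⟩
  exact hh ⟨c + Q, by rw [map_add, ← hc]; ring⟩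

theorem not_const_inv {h : RatFunc ℂ} (hh : ¬∃ c, h = RatFunc.C c) :
    ¬∃ c, h⁻¹ = RatFunc.C c := by
  rintro ⟨c, hc⟩
  exact hh ⟨c⁻¹, by rw [map_inv₀, ← hc, inv_inv]⟩

theorem not_const_X : ¬∃ c, (RatFunc.X : RatFunc ℂ) = RatFunc.C c :=
  not_const_of_intDegree_ne_zero (by simp)

theorem not_const_add {h : RatFunc ℂ} (hh : ¬∃ c, h = RatFunc.C c) (Q : ℂ) :
    ¬∃ c, h + RatFunc.C Q = RatFunc.C c := by
  simpa using not_const_sub hh (-Q)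

/-- A nonconstant rational function without a pole at `∞` becomes one with a pole at `∞` after
some substitution `1 / (y - Q)`. -/
theorem exists_intDegree_sub_C_neg {h : RatFunc ℂ} (hh : ¬∃ c, h = RatFunc.C c)
    (hd : h.intDegree ≤ 0) : ∃ Q, (h - RatFunc.C Q).intDegree < 0 := by
  -- This coefficient is the value of `h` at `∞`, because the denominator is monic; it is `0` if the
  -- numerator has smaller degree.
  refine ⟨h.num.coeff h.denom.natDegree, ?_⟩
  set Q := h.num.coeff h.denom.natDegree with hQ
  have hs0 := num_sub_C_mul_denom_ne_zero hh Q
  have hle : h.num.natDegree ≤ h.denom.natDegree := by unfold intDegree at hd; omega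
  have hdle : (h.num - Polynomial.C Q * h.denom).natDegree ≤ h.denom.natDegree :=
    (natDegree_sub_le _ _).trans (max_le hle (natDegree_C_mul_le _ _))
  have hcoeff : (h.num - Polynomial.C Q * h.denom).coeff h.denom.natDegree = 0 := by
    rw [coeff_sub, coeff_C_mul, coeff_natDegree, h.monic_denom.leadingCoeff, mul_one, hQ, sub_self]
  have hlt : (h.num - Polynomial.C Q * h.denom).natDegree ≠ h.denom.natDegree := fun e => by
    rw [← e, coeff_natDegree] at hcoeff
    exact hs0 (leadingCoeff_eq_zero.1 hcoeff)
  rw [sub_C_eq_div, intDegree_div (algebraMap_ne_zero hs0) (algebraMap_ne_zero h.denom_ne_zero),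
    intDegree_polynomial, intDegree_polynomial]
  omega

theorem ratComp_const (g : RatFunc ℂ) (c : ℂ) :
    ∃ d, ratComp g (RatFunc.C c) = RatFunc.C d :=
  -- At a pole of `g` both sides are `0`, by division by zero.
  ⟨g.num.eval c / g.denom.eval c, by
    rw [ratComp, RatFunc.eval, eval₂_at_apply, eval₂_at_apply, map_div₀]⟩

theorem not_const_of_ratComp {g h : RatFunc ℂ} (hf : ¬∃ c, ratComp g h = RatFunc.C c) :
    ¬∃ c, h = RatFunc.C c := by
  rintro ⟨c, rfl⟩
  exact hf (ratComp_const g c)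

theorem ratDegree_X_add_C (Q : ℂ) : ratDegree (RatFunc.X + RatFunc.C Q) = 1 := by
  have : RatFunc.X + RatFunc.C Q =
      algebraMap ℂ[X] (RatFunc ℂ) (Polynomial.X + Polynomial.C Q) := by simp
  rw [this, ratDegree, num_algebraMap, denom_algebraMap, natDegree_X_add_C, natDegree_one]
  rfl

theorem X_add_C_ne_zero' (Q : ℂ) : (RatFunc.X + RatFunc.C Q : RatFunc ℂ) ≠ 0 := by
  simpa using X_sub_C_ne_zero' (-Q)

theorem ratDegree_inv_X_add_C_add_C (Q Q₀ : ℂ) :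
    ratDegree ((RatFunc.X + RatFunc.C Q)⁻¹ + RatFunc.C Q₀) = 1 := by
  have : (RatFunc.X + RatFunc.C Q)⁻¹ + RatFunc.C Q₀ =
      algebraMap ℂ[X] (RatFunc ℂ) (1 + Polynomial.C Q₀ * (Polynomial.X + Polynomial.C Q)) /
      algebraMap ℂ[X] (RatFunc ℂ) (Polynomial.X + Polynomial.C Q) := by
    have := X_add_C_ne_zero' Q
    simp only [map_add, map_mul, map_one, algebraMap_X, algebraMap_C]
    field_simp
  rw [this, ratDegree_div (Polynomial.X_add_C_ne_zero Q) ⟨1, -Polynomial.C Q₀, by ring⟩,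
    natDegree_X_add_C, max_eq_right_iff]
  refine (natDegree_add_le _ _).trans (max_le (by simp) ?_)
  exact (natDegree_C_mul_le _ _).trans (natDegree_X_add_C Q).le

theorem isCompInverse_translation (Q : ℂ) :
    IsCompInverse (RatFunc.X + RatFunc.C Q) (RatFunc.X - RatFunc.C Q) := by
  constructor
  · rw [← compHom_apply _ (not_const_sub not_const_X Q)]
    simp [compHom_X, compHom_C]
  · rw [← compHom_apply _ (not_const_add not_const_X Q)]
    simp [compHom_X, compHom_C]

theorem isCompInverse_inv_translation (Q Q₀ : ℂ) :
    IsCompInverse ((RatFunc.X + RatFunc.C Q)⁻¹ + RatFunc.C Q₀)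
      ((RatFunc.X - RatFunc.C Q₀)⁻¹ - RatFunc.C Q) := by
  constructor
  · rw [← compHom_apply _ (not_const_sub (not_const_inv (not_const_sub not_const_X Q₀)) Q)]
    simp [compHom_X, compHom_C]
  · rw [← compHom_apply _ (not_const_add (not_const_inv (not_const_add not_const_X Q)) Q₀)]
    simp [compHom_X, compHom_C]

theorem exists_decomposition_of_orders {n : ℕ} (hn : 1 < n) {g h : RatFunc ℂ}
    (hfpos : 0 < (ratComp g h).intDegree)
    (hfd : IsCoprime (n : ℤ) (ratComp g h).intDegree)
    (hf0 : IsCoprime (n : ℤ) (ordAt 0 (ratComp g h)))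
    (hf : ∀ P, P ≠ 0 → 0 ≤ ordAt P (ratComp g h) ∧ (n : ℤ) ∣ ordAt P (ratComp g h)) :
    ∃ μ ν : RatFunc ℂ, ratDegree μ = 1 ∧ IsCompInverse μ ν ∧
      ∃ (i j : ℤ) (G H : ℂ[X]),
        ratComp g μ = RatFunc.X ^ i * algebraMap ℂ[X] (RatFunc ℂ) G ^ n ∧
        ratComp ν h = RatFunc.X ^ j * algebraMap ℂ[X] (RatFunc ℂ) H ^ n := by
  have hh := not_const_of_ratComp (not_const_of_intDegree_ne_zero hfpos.ne')
  have hg : g ≠ 0 := by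
    rintro rfl
    simp [ratComp] at hfpos
  have hn0 : 0 < n := by omega
  rcases lt_or_ge 0 h.intDegree with hd | hd
  · obtain ⟨Q, h1, h2⟩ := exists_translate hn hg hd hfpos hfd hf0 hf
    obtain ⟨i, j, G, H, hG, hH⟩ := exists_decomposition_of_translate hn0 hg hh h1 h2
    refine ⟨_, _, ratDegree_X_add_C Q, isCompInverse_translation Q, i, j, G, H, hG, ?_⟩
    rw [← hH, ← compHom_apply h hh, map_sub, compHom_X, compHom_C]
  · obtain ⟨Q₀, hQ₀⟩ := exists_intDegree_sub_C_neg hh hd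
    set h₁ := (h - RatFunc.C Q₀)⁻¹ with hh₁
    -- Chosen so that `m ∘ h₁ = h`: the composition is unchanged, while the inner function now has a
    -- pole at `∞`.
    set m : RatFunc ℂ := RatFunc.X⁻¹ + RatFunc.C Q₀ with hm
    have hh₁c : ¬∃ c, h₁ = RatFunc.C c := not_const_inv (not_const_sub hh Q₀)
    have hmc : ¬∃ c, m = RatFunc.C c := not_const_add (not_const_inv not_const_X) Q₀
    have hd₁ : 0 < h₁.intDegree := by rw [hh₁, intDegree_inv]; omega
    have hg₁ : ratComp g m ≠ 0 := by
      rw [← compHom_apply _ hmc]; simpa using hg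
    have hcomp : ratComp (ratComp g m) h₁ = ratComp g h := by
      rw [ratComp_ratComp _ _ _ hmc hh₁c]
      congr 1
      rw [← compHom_apply _ hh₁c, hm, map_add, map_inv₀, compHom_X, compHom_C, hh₁]
      simp
    rw [← hcomp] at hfpos hfd hf0 hf
    obtain ⟨Q, h1, h2⟩ := exists_translate hn hg₁ hd₁ hfpos hfd hf0 hf
    obtain ⟨i, j, G, H, hG, hH⟩ := exists_decomposition_of_translate hn0 hg₁ hh₁c h1 h2
    refine ⟨_, _, ratDegree_inv_X_add_C_add_C Q Q₀, isCompInverse_inv_translation Q Q₀,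
      i, j, G, H, ?_, ?_⟩
    · have hXQ := not_const_add not_const_X Q
      rw [← hG, ratComp_ratComp _ _ _ hmc hXQ]
      congr 1
      rw [← compHom_apply _ hXQ, hm, map_add, map_inv₀, compHom_X, compHom_C]
    · rw [← hH, ← compHom_apply h hh, map_sub, map_inv₀, map_sub, compHom_X, compHom_C, compHom_C]

/-! ### The orders of `x^r p(x)^n` and the inversion `x ↦ 1/x`. -/

theorem exists_decomposition_of_pos {n : ℕ} (hn : 1 < n) {r : ℤ} (hnr : IsCoprime (n : ℤ) r)
    {p : ℂ[X]} (hp : ¬ Polynomial.X ∣ p) (hpos : 0 < r + n * p.natDegree) {g h : RatFunc ℂ}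
    (hgh : ratComp g h = RatFunc.X ^ r * algebraMap ℂ[X] (RatFunc ℂ) p ^ n) :
    ∃ μ ν : RatFunc ℂ, ratDegree μ = 1 ∧ IsCompInverse μ ν ∧
      ∃ (i j : ℤ) (G H : ℂ[X]),
        ratComp g μ = RatFunc.X ^ i * algebraMap ℂ[X] (RatFunc ℂ) G ^ n ∧
        ratComp ν h = RatFunc.X ^ j * algebraMap ℂ[X] (RatFunc ℂ) H ^ n := by
  have hp0 : p ≠ 0 := fun e => hp (e ▸ dvd_zero _)
  have hpm := algebraMap_ne_zero hp0
  have hX : (RatFunc.X : RatFunc ℂ) ≠ 0 := RatFunc.X_ne_zero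
  have hord : ∀ P, ordAt P (ratComp g h) = r * ordAt P RatFunc.X + n * p.rootMultiplicity P := by
    intro P
    rw [hgh, ordAt_mul P (zpow_ne_zero _ hX) (pow_ne_zero _ hpm), ordAt_zpow P hX,
      ordAt_pow P hpm, ordAt_algebraMap]
  have hdeg : (ratComp g h).intDegree = r + n * p.natDegree := by
    rw [hgh, intDegree_mul (zpow_ne_zero _ hX) (pow_ne_zero _ hpm), intDegree_zpow hX,
      intDegree_pow hpm, intDegree_polynomial, intDegree_X, mul_one]
  have hX0 : ordAt 0 RatFunc.X = 1 := by simpa using ordAt_X_sub_C_self 0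
  refine exists_decomposition_of_orders hn (hdeg ▸ hpos) ?_ ?_ fun P hP => ?_
  · rw [hdeg]
    exact hnr.add_mul_left_right _
  · rw [hord, hX0, mul_one]
    exact hnr.add_mul_left_right _
  · have hXP : ordAt P RatFunc.X = 0 := by simpa using ordAt_X_sub_C_of_ne hP
    rw [hord, hXP, mul_zero, zero_add]
    exact ⟨by positivity, dvd_mul_right _ _⟩

theorem compHom_inv_X_algebraMap (hc : ¬∃ c, (RatFunc.X : RatFunc ℂ)⁻¹ = RatFunc.C c)
    (p : ℂ[X]) : compHom RatFunc.X⁻¹ hc (algebraMap ℂ[X] (RatFunc ℂ) p) =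
      RatFunc.X ^ (-(p.natDegree : ℤ)) * algebraMap ℂ[X] (RatFunc ℂ) p.reverse := by
  have hX : (RatFunc.X : RatFunc ℂ) ≠ 0 := RatFunc.X_ne_zero
  let _ : Invertible (RatFunc.X : RatFunc ℂ)⁻¹ := invertibleOfNonzero (inv_ne_zero hX)
  have h := eval₂_reverse_mul_pow (RatFunc.C (K := ℂ)) RatFunc.X⁻¹ p
  rw [invOf_eq_inv, inv_inv] at h
  rw [compHom_apply, ratComp, eval_algebraMap, Algebra.algebraMap_self, RingHom.id_apply, ← h,
    ← aeval_X_left_eq_algebraMap, zpow_neg, zpow_natCast, inv_pow, mul_comm]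
  rfl

/-- The form `x^r p^n` is stable under `x ↦ 1/x`, which exchanges `0` and `∞`. This is used to move
a pole of `g ∘ h` to `∞` and again to undo the move. -/
theorem compHom_inv_X_zpow_mul_pow (hc : ¬∃ c, (RatFunc.X : RatFunc ℂ)⁻¹ = RatFunc.C c)
    (r : ℤ) (p : ℂ[X]) (n : ℕ) :
    compHom RatFunc.X⁻¹ hc (RatFunc.X ^ r * algebraMap ℂ[X] (RatFunc ℂ) p ^ n) =
      RatFunc.X ^ (-(r + n * p.natDegree)) * algebraMap ℂ[X] (RatFunc ℂ) p.reverse ^ n := by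
  have hX : (RatFunc.X : RatFunc ℂ) ≠ 0 := RatFunc.X_ne_zero
  rw [map_mul, map_zpow₀, map_pow, compHom_X, compHom_inv_X_algebraMap, mul_pow, ← mul_assoc,
    inv_zpow', ← zpow_natCast, ← zpow_mul, ← zpow_add₀ hX]
  congr 2
  ring

theorem proposition4p2 (n : ℕ) (r : ℤ) (hn : 1 < n) (hnr : Int.gcd (n : ℤ) r = 1)
    (p : Polynomial ℂ) (hp : ¬ Polynomial.X ∣ p) (g h : RatFunc ℂ)
    (hgh : ratComp g h =
      (RatFunc.X : RatFunc ℂ) ^ r * (algebraMap (Polynomial ℂ) (RatFunc ℂ) p) ^ n) :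
    ∃ μ ν : RatFunc ℂ, ratDegree μ = 1 ∧ IsCompInverse μ ν ∧
      ∃ (i j : ℤ) (G H : Polynomial ℂ),
        ratComp g μ =
          (RatFunc.X : RatFunc ℂ) ^ i * (algebraMap (Polynomial ℂ) (RatFunc ℂ) G) ^ n ∧
        ratComp ν h =
          (RatFunc.X : RatFunc ℂ) ^ j * (algebraMap (Polynomial ℂ) (RatFunc ℂ) H) ^ n := by
  have hcop : IsCoprime (n : ℤ) r := Int.isCoprime_iff_gcd_eq_one.2 hnr
  have hp0 : p ≠ 0 := fun e => hp (e ▸ dvd_zero _)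
  rcases lt_or_ge 0 (r + n * p.natDegree) with hpos | hnpos
  · exact exists_decomposition_of_pos hn hcop hp hpos hgh
  -- `r = 0` would give `gcd(n, r) = n > 1`.
  have hr : r < 0 := by
    have h1 : (0 : ℤ) ≤ n * p.natDegree := by positivity
    refine lt_of_le_of_ne (by omega) ?_
    rintro rfl
    simp at hnr
    omega
  have hpm := algebraMap_ne_zero hp0
  have hX : (RatFunc.X : RatFunc ℂ) ≠ 0 := RatFunc.X_ne_zero
  have hcoeff : p.coeff 0 ≠ 0 := fun e => hp (X_dvd_iff.2 e)
  have hinv := not_const_inv not_const_X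
  -- The composition has order `r ≠ 0` at the origin, so it is not constant.
  have hh : ¬∃ c, h = RatFunc.C c := by
    apply not_const_of_ratComp (g := g)
    rintro ⟨c, hc⟩
    have := congrArg (ordAt 0) (hgh.symm.trans hc)
    rw [ordAt_C, ordAt_mul 0 (zpow_ne_zero _ hX) (pow_ne_zero _ hpm), ordAt_zpow 0 hX,
      ordAt_pow 0 hpm, ordAt_algebraMap, rootMultiplicity_eq_zero
        (by rwa [IsRoot, ← coeff_zero_eq_eval_zero]), show ordAt 0 RatFunc.X = 1 by
        simpa using ordAt_X_sub_C_self 0] at this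
    simp at this
    omega
  have hgh' : ratComp g (ratComp h RatFunc.X⁻¹) =
      RatFunc.X ^ (-(r + n * p.natDegree)) * algebraMap ℂ[X] (RatFunc ℂ) p.reverse ^ n := by
    rw [← ratComp_ratComp _ _ _ hh hinv, hgh, ← compHom_apply _ hinv, compHom_inv_X_zpow_mul_pow]
  have hdeg : p.reverse.natDegree = p.natDegree := by
    rw [reverse_natDegree, natTrailingDegree_eq_zero_of_constantCoeff_ne_zero (by simpa using hcoeff),
      Nat.sub_zero]
  -- After inversion the degree is `-(r + n * deg p) + n * deg p = -r > 0`, as reversal keeps the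
  -- degree of `p` when `p(0) ≠ 0`.
  obtain ⟨μ, ν, hμ, hμν, i, j, G, H, hG, hH⟩ := exists_decomposition_of_pos hn
    (by rw [IsCoprime.neg_right_iff]; exact hcop.add_mul_left_right _)
    (by rwa [X_dvd_iff, coeff_zero_reverse, leadingCoeff_eq_zero]) (by rw [hdeg]; omega) hgh'
  -- Only the inner function was inverted, so `μ` and `G` stay; a second inversion turns `x^j H^n`
  -- into the stated exponent and the reversed polynomial.
  refine ⟨μ, ν, hμ, hμν, i, -(j + n * H.natDegree), G, H.reverse, hG, ?_⟩
  rw [← ratComp_ratComp _ _ _ hh hinv] at hH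
  rw [← compHom_inv_X_zpow_mul_pow hinv, ← hH, compHom_apply,
    ratComp_ratComp _ _ _ hinv hinv, ← compHom_apply _ hinv RatFunc.X⁻¹, map_inv₀, compHom_X, inv_inv,
    ratComp_X]
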